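/- All graphs are finite, undirected, without loops and multiple edges. For a graph $G$ and positive integers $a_1,\dots,a_r$ write $G\to(a_1,\dots,a_r)$ if for every partition $V(G)=V_1\cup\dots\cup V_r$ into pairwise disjoint (possibly empty) classes there is an $i$ such that $V_i$ contains an $a_i$-clique, i.e. $a_i$ pairwise adjacent vertices of $G$. Let $cl(G)$ be the largest number of vertices of a clique of $G$, and let $$F(a_1,\dots,a_r;q)=\min\{|V(G)| : G\to(a_1,\dots,a_r)\text{ and } cl(G)<q\}$$ be the vertex Folkman number. Let $p\ge 4$ be an integer. Then $F(2,2,p;p+1)$ exists (there is a graph $G$ with $G\to(2,2,p)$ and $cl(G)<p+1$), and $$F(2,2,p;p+1)\le \frac{13p}{4}\quad\text{if } p\equiv 0 \pmod 4,$$ $$F(2,2,p;p+1)\le \frac{13p+23}{4}\quad\text{if } p\equiv 1 \pmod 4,$$ $$F(2,2,p;p+1)\le \frac{13p+10}{4}\quad\text{if } p\equiv 2 \pmod 4,$$ $$F(2,2,p;p+1)\le \frac{13p+21}{4}\quad\text{if } p\equiv 3 \pmod 4.$$ -/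

import Mathlib

namespace VertexFolkman

/-- A colouring `c` of the vertices of `G` with `r` colours (the class `V_i` is the set of vertices
of colour `i`) is `(a_1, ..., a_r)`-free if, for each `i`, no `a_i`-clique of `G` lies in `V_i`. -/
def IsFree {V : Type} (G : SimpleGraph V) {r : ℕ} (a : Fin r → ℕ) (c : V → Fin r) : Prop :=
  ∀ i : Fin r, ¬ ∃ s : Finset V, G.IsNClique (a i) s ∧ ∀ v ∈ s, c v = i

/-- `G → (a_1, ..., a_r)`: there is no `(a_1, ..., a_r)`-free colouring of the vertices of `G`. -/
def Arrows {V : Type} (G : SimpleGraph V) {r : ℕ} (a : Fin r → ℕ) : Prop :=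
  ¬ ∃ c : V → Fin r, IsFree G a c

/-- The set of the numbers `|V(G)|`, where `G` runs over the finite graphs with
`G → (a_1, ..., a_r)` and `cl(G) < q`. -/
def orders {r : ℕ} (a : Fin r → ℕ) (q : ℕ) : Set ℕ :=
  {n | ∃ (V : Type) (_ : Fintype V) (G : SimpleGraph V),
    Arrows G a ∧ G.cliqueNum < q ∧ Fintype.card V = n}

/-- The vertex Folkman number `F(a_1, ..., a_r; q)`, the least element of `orders a q`.
It is meaningful only if `orders a q` is non-empty. -/
noncomputable def F {r : ℕ} (a : Fin r → ℕ) (q : ℕ) : ℕ :=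
  sInf (orders a q)

end VertexFolkman

/-! Joins make the problem additive: if `G → (2,2,p)` with clique number at most `p` and `H →
(2,2,q)` with clique number at most `q`, the join has clique number at most `p + q`, and a colouring
of it with two independent classes leaves a `p`-clique in `G` and a `q`-clique in `H` in the third
colour, which unite to a `(p+q)`-clique. Adding 13-vertex graphs for `p = 4` gives slope 13/4, so
one starting graph for each of `p = 4, 5, 6, 7` suffices. These are complements of triangle-free
graphs: the first two classes have at most two vertices each, so a finite enumeration checks them.
-/

namespace VertexFolkman

/-! ### Enumerating cliques -/

/-- The sublists of `l` of length `k` whose members are pairwise related by `r`. -/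
def cliqueLists {α : Type} (r : α → α → Bool) : ℕ → List α → List (List α)
  | 0, _ => [[]]
  | k + 1, l => l.tails.flatMap fun
    | [] => []
    | v :: t => (cliqueLists r k (t.filter (r v))).map (v :: ·)

theorem mem_cliqueLists {α : Type} {r : α → α → Bool} {k : ℕ} {l s : List α} :
    s ∈ cliqueLists r k l ↔ s.Sublist l ∧ s.length = k ∧ s.Pairwise fun a b => r a b = true := by
  induction k generalizing l s with
  | zero =>
    simp only [cliqueLists, List.mem_singleton, List.length_eq_zero_iff]
    constructor
    · rintro rfl
      simp
    · exact fun h => h.2.1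
  | succ k ih =>
    simp only [cliqueLists, List.mem_flatMap, List.mem_tails]
    constructor
    · rintro ⟨u, hu, hs⟩
      cases u with
      | nil => simp at hs
      | cons v t =>
        obtain ⟨s', hs', rfl⟩ := List.mem_map.1 hs
        obtain ⟨h1, h2, h3⟩ := ih.1 hs'
        refine ⟨((h1.trans List.filter_sublist).cons_cons v).trans hu.sublist, by simp [h2],
          List.pairwise_cons.2 ⟨fun b hb => ?_, h3⟩⟩
        exact (List.mem_filter.1 (h1.subset hb)).2
    · rintro ⟨h1, h2, h3⟩
      cases s with
      | nil => simp at h2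
      | cons v s' =>
        obtain ⟨hv, h3⟩ := List.pairwise_cons.1 h3
        obtain ⟨l₁, l₂, rfl, hv', hs'⟩ := List.cons_sublist_iff.1 h1
        obtain ⟨m₁, m₂, rfl⟩ := List.append_of_mem hv'
        refine ⟨v :: (m₂ ++ l₂), ⟨m₁, by simp⟩, List.mem_map.2 ⟨s', ih.2 ⟨?_, ?_, h3⟩, rfl⟩⟩
        · have := (hs'.trans (List.sublist_append_right m₂ l₂)).filter (r v)
          rwa [List.filter_eq_self.2 hv] at this
        · simpa using h2

/-- The first `k + 1` members of a longer clique would form a listed clique. -/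
theorem length_le_of_cliqueLists_eq_nil {α : Type} {r : α → α → Bool} {k : ℕ} {l s : List α}
    (h : cliqueLists r (k + 1) l = []) (hs : s.Sublist l)
    (hr : s.Pairwise fun a b => r a b = true) : s.length ≤ k := by
  by_contra! hk
  have : s.take (k + 1) ∈ cliqueLists r (k + 1) l :=
    mem_cliqueLists.2 ⟨(List.take_sublist _ _).trans hs, by simp; omega,
      hr.sublist (List.take_sublist _ _)⟩
  simp [h] at this

/-! ### Graphs given by a Boolean relation -/

/-- The graph on `Fin n` in which distinct vertices are adjacent if `r` holds. -/
def boolGraph {n : ℕ} (r : Fin n → Fin n → Bool) (hr : ∀ a b, r a b = r b a) :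
    SimpleGraph (Fin n) where
  Adj a b := a ≠ b ∧ r a b = true
  symm := ⟨fun a b h => ⟨h.1.symm, hr a b ▸ h.2⟩⟩
  loopless := ⟨fun _ h => h.1 rfl⟩

/-- Sufficient conditions, by enumeration, for the graph of `r` to have no `(p+1)`-clique, no
independent set of size `m + 1`, and a `p`-clique outside the union of any two independent sets. -/
def arrowsCheck {n : ℕ} (r : Fin n → Fin n → Bool) (m p : ℕ) : Bool :=
  (cliqueLists r (p + 1) (List.finRange n)).isEmpty &&
  (cliqueLists (fun a b => !r a b) (m + 1) (List.finRange n)).isEmpty &&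
  let I := (List.range (m + 1)).flatMap fun k =>
    cliqueLists (fun a b => !r a b) k (List.finRange n)
  I.all fun A =>
    let L := (cliqueLists r p (List.finRange n)).filter fun K => A.all fun a => !K.contains a
    I.all fun B => L.any fun K => B.all fun b => !K.contains b

theorem mem_orders_of_arrowsCheck {n : ℕ} (r : Fin n → Fin n → Bool) (m p : ℕ)
    (hr : ∀ a b, r a b = r b a) (h : arrowsCheck r m p = true) :
    n ∈ orders ![2, 2, p] (p + 1) := by
  simp only [arrowsCheck, Bool.and_eq_true, List.isEmpty_iff] at h
  obtain ⟨⟨hp, hm⟩, h⟩ := h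
  refine ⟨Fin n, inferInstance, boolGraph r hr, ?_, ?_, Fintype.card_fin n⟩
  · rintro ⟨c, hc⟩
    -- The classes of the first two colours are independent, hence among the enumerated sets.
    have key : ∀ i : Fin 3, ![2, 2, p] i = 2 → (List.finRange n).filter (c · = i) ∈
        (List.range (m + 1)).flatMap fun k =>
          cliqueLists (fun a b => !r a b) k (List.finRange n) := by
      intro i hi
      have hpair : ((List.finRange n).filter (c · = i)).Pairwise
          fun a b => (!r a b) = true := by
        have hnd := (List.nodup_finRange n).filter (c · = i)
        refine List.Pairwise.imp_of_mem (fun {a b} ha hb hab => ?_) hnd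
        by_contra hrab
        refine hc i ⟨{a, b}, ?_, ?_⟩
        · rw [hi, SimpleGraph.isNClique_iff, Finset.card_pair hab]
          refine ⟨?_, rfl⟩
          rw [Finset.coe_pair, SimpleGraph.isClique_pair]
          exact fun _ => ⟨hab, by simpa using hrab⟩
        · simp only [List.mem_filter, decide_eq_true_eq] at ha hb
          intro v hv
          rcases Finset.mem_insert.1 hv with rfl | hv
          · exact ha.2
          · rw [Finset.mem_singleton.1 hv]
            exact hb.2
      refine List.mem_flatMap.2 ⟨_, List.mem_range.2 (Nat.lt_succ_of_le
        (length_le_of_cliqueLists_eq_nil hm List.filter_sublist hpair)),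
        mem_cliqueLists.2 ⟨List.filter_sublist, rfl, hpair⟩⟩
    have h0 := List.all_eq_true.1 h _ (key 0 rfl)
    obtain ⟨K, hK, hB⟩ := List.any_eq_true.1 (List.all_eq_true.1 h0 _ (key 1 rfl))
    obtain ⟨hK, hA⟩ := List.mem_filter.1 hK
    obtain ⟨hsub, hlen, hpair⟩ := mem_cliqueLists.1 hK
    have hnd : K.Nodup := hsub.nodup (List.nodup_finRange n)
    refine hc 2 ⟨K.toFinset, ?_, fun v hv => ?_⟩
    · rw [SimpleGraph.isNClique_iff, List.toFinset_card_of_nodup hnd]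
      refine ⟨?_, hlen⟩
      have : K.Pairwise (boolGraph r hr).Adj := (hnd.and hpair).imp fun h => h
      have symm := (boolGraph r hr).symm
      rw [SimpleGraph.isClique_iff, List.coe_toFinset]
      exact this.set_pairwise
    · have hv := List.mem_toFinset.1 hv
      simp only [List.all_eq_true, List.mem_filter, List.mem_finRange, true_and,
        decide_eq_true_eq, Bool.not_eq_true', List.contains_eq_mem, decide_eq_false_iff_not] at hA hB
      exact (by decide : ∀ i : Fin 3, i ≠ 0 → i ≠ 1 → i = 2) (c v) (fun h => hA v h hv)
        (fun h => hB v h hv)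
  · obtain ⟨s, hs⟩ := (boolGraph r hr).exists_isNClique_cliqueNum
    have hlen : ((List.finRange n).filter (· ∈ s)).length = s.card := by
      rw [← List.toFinset_card_of_nodup ((List.nodup_finRange n).filter _)]
      congr 1
      ext
      simp
    rw [← hs.card_eq, ← hlen, Nat.lt_succ_iff]
    refine length_le_of_cliqueLists_eq_nil hp List.filter_sublist ?_
    refine List.Pairwise.imp_of_mem (fun {a b} ha hb hab => ?_)
      ((List.nodup_finRange n).filter (· ∈ s))
    simp only [List.mem_filter, decide_eq_true_eq] at ha hb
    exact (hs.isClique ha.2 hb.2 hab).2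

/-! ### Four small graphs -/

/-- Non-adjacency to `u + d` for the members `d` of the set with binary code `D`. -/
def circulantCompl (n D : ℕ) (u v : Fin n) : Bool :=
  !D.testBit ((u + (n - v)) % n)

/-- The complement of a 4-regular triangle-free graph on two copies of `ℤ/8ℤ`: in each copy `i` is
joined to `i + 4`, and `i` in the first copy to `i`, `i + 1`, `i + 3` in the second. -/
def bicirculantCompl (u v : Fin 16) : Bool :=
  let d := (u + (16 - v) : ℕ) % 8
  if (u : ℕ) < 8 then
    if (v : ℕ) < 8 then d != 4 else d != 0 && d != 7 && d != 5
  else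
    if (v : ℕ) < 8 then d != 0 && d != 1 && d != 3 else d != 4

/-- The differences ±1, ±5 are the nonzero cubes mod 13; they give the Ramsey graph for R(3,5) = 14,
with no triangle and no independent 5-set. -/
theorem thirteen_mem_orders : 13 ∈ orders ![2, 2, 4] 5 :=
  mem_orders_of_arrowsCheck (circulantCompl 13 (2 ^ 1 + 2 ^ 5 + 2 ^ 8 + 2 ^ 12)) 2 4
    (by decide +kernel) (by decide +kernel)

theorem sixteen_mem_orders : 16 ∈ orders ![2, 2, 5] 6 :=
  mem_orders_of_arrowsCheck bicirculantCompl 2 5 (by decide +kernel) (by decide +kernel)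

theorem eighteen_mem_orders : 18 ∈ orders ![2, 2, 6] 7 :=
  mem_orders_of_arrowsCheck (circulantCompl 18 (2 ^ 2 + 2 ^ 3 + 2 ^ 15 + 2 ^ 16)) 2 6
    (by decide +kernel) (by decide +kernel)

theorem twentyFour_mem_orders : 24 ∈ orders ![2, 2, 7] 8 :=
  mem_orders_of_arrowsCheck
    (circulantCompl 24 (2 ^ 1 + 2 ^ 6 + 2 ^ 10 + 2 ^ 14 + 2 ^ 18 + 2 ^ 23)) 2 7
    (by decide +kernel) (by decide +kernel)

/-! ### Joins -/

/-- The join of two graphs: their disjoint union with all edges between the two parts. -/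
def join {V W : Type} (G : SimpleGraph V) (H : SimpleGraph W) : SimpleGraph (V ⊕ W) where
  Adj
    | .inl a, .inl b => G.Adj a b
    | .inr a, .inr b => H.Adj a b
    | _, _ => True
  symm := ⟨by
    rintro (a | a) (b | b) h
    exacts [G.adj_symm h, trivial, trivial, H.adj_symm h]⟩
  loopless := ⟨by
    rintro (a | a) h
    exacts [G.irrefl h, H.irrefl h]⟩

/-- Pull the colouring back to `G`: its first two classes stay independent, so the third must
contain a `p`-clique, whatever `q` is. -/
theorem exists_isNClique_of_arrows {V W : Type} {G : SimpleGraph V} {H : SimpleGraph W} {p q : ℕ}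
    (hG : Arrows G ![2, 2, p]) (e : G ↪g H) (c : W → Fin 3) (hc : IsFree H ![2, 2, q] c) :
    ∃ s : Finset V, G.IsNClique p s ∧ ∀ v ∈ s, c (e v) = 2 := by
  by_contra hs
  have key : ∀ i : Fin 3, ![2, 2, q] i = 2 →
      ¬ ∃ s : Finset V, G.IsNClique 2 s ∧ ∀ v ∈ s, c (e v) = i := by
    rintro i hi ⟨s, hs, hsc⟩
    refine hc i ⟨s.map e.toEmbedding, ?_, ?_⟩
    · rw [hi]
      exact (hs.map (f := e.toEmbedding)).mono
        (SimpleGraph.map_le_iff_le_comap .. |>.2 fun a b h => e.map_adj_iff.2 h)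
    · intro v hv
      obtain ⟨a, ha, rfl⟩ := Finset.mem_map.1 hv
      exact hsc a ha
  refine hG ⟨c ∘ e, fun i => ?_⟩
  fin_cases i
  · exact key 0 rfl
  · exact key 1 rfl
  · exact hs

theorem add_mem_orders {p q m n : ℕ} (hm : m ∈ orders ![2, 2, p] (p + 1))
    (hn : n ∈ orders ![2, 2, q] (q + 1)) : m + n ∈ orders ![2, 2, p + q] (p + q + 1) := by
  obtain ⟨V, _, G, hG, hGp, rfl⟩ := hm
  obtain ⟨W, _, H, hH, hHq, rfl⟩ := hn
  refine ⟨V ⊕ W, inferInstance, join G H, ?_, ?_, Fintype.card_sum⟩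
  · rintro ⟨c, hc⟩
    obtain ⟨s, hs, hsc⟩ := exists_isNClique_of_arrows (H := join G H) hG
      ⟨Function.Embedding.inl, Iff.rfl⟩ c hc
    obtain ⟨t, ht, htc⟩ := exists_isNClique_of_arrows (H := join G H) hH
      ⟨Function.Embedding.inr, Iff.rfl⟩ c hc
    refine hc 2 ⟨s.disjSum t, ⟨?_, ?_⟩, ?_⟩
    · rintro (a | a) ha (b | b) hb hab
      · exact hs.isClique (by simpa using ha) (by simpa using hb) (by simpa using hab)
      · trivial
      · trivial
      · exact ht.isClique (by simpa using ha) (by simpa using hb) (by simpa using hab)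
    · rw [Finset.card_disjSum, hs.card_eq, ht.card_eq]
      rfl
    · rintro (a | a) ha
      · exact hsc a (by simpa using ha)
      · exact htc a (by simpa using ha)
  -- A maximum clique of the join splits into a clique of `G` and a clique of `H`.
  · obtain ⟨s, hs⟩ := (join G H).exists_isNClique_cliqueNum
    have hl : G.IsClique (s.toLeft : Set V) := fun a ha b hb hab =>
      hs.isClique (x := .inl a) (by simpa using ha) (y := .inl b) (by simpa using hb)
        (by simpa using hab)
    have hr : H.IsClique (s.toRight : Set W) := fun a ha b hb hab =>
      hs.isClique (x := .inr a) (by simpa using ha) (y := .inr b) (by simpa using hb)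
        (by simpa using hab)
    have h1 := hl.card_le_cliqueNum
    have h2 := hr.card_le_cliqueNum
    have h3 := s.card_toLeft_add_card_toRight
    have h4 := hs.card_eq
    omega

theorem add_mul_mem_orders {p n : ℕ} (h : n ∈ orders ![2, 2, p] (p + 1)) (k : ℕ) :
    n + 13 * k ∈ orders ![2, 2, p + 4 * k] (p + 4 * k + 1) := by
  induction k with
  | zero => exact h
  | succ k ih =>
    have h := add_mem_orders ih thirteen_mem_orders
    exact h

end VertexFolkman

theorem corollary2 (p : ℕ) (hp : 4 ≤ p) :
    (VertexFolkman.orders ![2, 2, p] (p + 1)).Nonempty ∧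
    (p ≡ 0 [MOD 4] → (VertexFolkman.F ![2, 2, p] (p + 1) : ℝ) ≤ 13 * (p : ℝ) / 4) ∧
    (p ≡ 1 [MOD 4] → (VertexFolkman.F ![2, 2, p] (p + 1) : ℝ) ≤ (13 * (p : ℝ) + 23) / 4) ∧
    (p ≡ 2 [MOD 4] → (VertexFolkman.F ![2, 2, p] (p + 1) : ℝ) ≤ (13 * (p : ℝ) + 10) / 4) ∧
    (p ≡ 3 [MOD 4] → (VertexFolkman.F ![2, 2, p] (p + 1) : ℝ) ≤ (13 * (p : ℝ) + 21) / 4) := by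
  have key : ∃ n ∈ VertexFolkman.orders ![2, 2, p] (p + 1),
      (p % 4 = 0 → 4 * n ≤ 13 * p) ∧ (p % 4 = 1 → 4 * n ≤ 13 * p + 23) ∧
      (p % 4 = 2 → 4 * n ≤ 13 * p + 10) ∧ (p % 4 = 3 → 4 * n ≤ 13 * p + 21) := by
    -- At `p = 4, 5, 6, 7` the bounds are 13, 22, 22, 28; the starting orders 13, 16, 18, 24 satisfy
    -- them, and both sides grow by 13 when `p` grows by 4.
    obtain ⟨k, rfl | rfl | rfl | rfl⟩ :
        ∃ k, p = 4 + 4 * k ∨ p = 5 + 4 * k ∨ p = 6 + 4 * k ∨ p = 7 + 4 * k :=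
      ⟨p / 4 - 1, by omega⟩
    · exact ⟨_, VertexFolkman.add_mul_mem_orders
        VertexFolkman.thirteen_mem_orders k, by omega⟩
    · exact ⟨_, VertexFolkman.add_mul_mem_orders
        VertexFolkman.sixteen_mem_orders k, by omega⟩
    · exact ⟨_, VertexFolkman.add_mul_mem_orders
        VertexFolkman.eighteen_mem_orders k, by omega⟩
    · exact ⟨_, VertexFolkman.add_mul_mem_orders
        VertexFolkman.twentyFour_mem_orders k, by omega⟩
  obtain ⟨n, hn, h0, h1, h2, h3⟩ := key
  have hF : (VertexFolkman.F ![2, 2, p] (p + 1) : ℝ) ≤ n := by exact_mod_cast Nat.sInf_le hn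
  refine ⟨⟨n, hn⟩, fun h => ?_, fun h => ?_, fun h => ?_, fun h => ?_⟩
  · have : (4 * n : ℝ) ≤ 13 * p := by exact_mod_cast h0 h
    linarith
  · have : (4 * n : ℝ) ≤ 13 * p + 23 := by exact_mod_cast h1 h
    linarith
  · have : (4 * n : ℝ) ≤ 13 * p + 10 := by exact_mod_cast h2 h
    linarith
  · have : (4 * n : ℝ) ≤ 13 * p + 21 := by exact_mod_cast h3 h
    linarith
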